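/- All graphs are finite and simple. An interval is a convex set of real numbers. A graph $G=(V,E)$ is an interval graph if one can assign to each $v\in V$ an interval $I_v$ so that distinct vertices $u,v$ are adjacent exactly when $I_u\cap I_v\neq\emptyset$. Let $\omega(G)$ be the number of vertices of a largest complete subgraph of $G$. Given an order $v_1,\dots,v_n$ of all the vertices of $G$, the first-fit algorithm assigns to $v_1,\dots,v_n$ in turn the colors $f(v_1),\dots,f(v_n)$, where $f(v_k)$ is the least positive integer that is not in $\{f(v_j) : 1\le j<k,\ v_jv_k\in E\}$. Let $\chi_{FF}(G)$ be the maximum, over all orders of the vertices, of the number of colors that first-fit uses on $G$. Put \[R:=\sup\left\{\frac{\chi_{FF}(G)}{\omega(G)} \;\middle|\; G \text{ is an interval graph with nonempty vertex set}\right\},\] the supremum being taken in the extended real line. Then $5\le R$. -/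

import Mathlib

namespace FirstFit

/-- A graph is an interval graph if its vertices can be assigned intervals (convex sets of real
numbers) so that distinct vertices are adjacent exactly when their intervals meet. -/
def IsIntervalGraph {V : Type*} (G : SimpleGraph V) : Prop :=
  ∃ I : V → Set ℝ, (∀ v, Convex ℝ (I v)) ∧
    ∀ u v, G.Adj u v ↔ u ≠ v ∧ (I u ∩ I v).Nonempty

/-- The color that first-fit gives to the `k`-th presented vertex `v k`: the least positive integer
that is not the color of an earlier neighbor. -/
noncomputable def color {V : Type*} (G : SimpleGraph V) {n : ℕ} (v : Fin n → V) (k : Fin n) : ℕ :=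
  sInf {c : ℕ | 0 < c ∧ ∀ (j : Fin n) (_ : j < k), G.Adj (v j) (v k) → color G v j ≠ c}
termination_by k

/-- The number of colors that first-fit uses when the vertices are presented in the order `v`. -/
noncomputable def numColors {V : Type*} (G : SimpleGraph V) {n : ℕ} (v : Fin n → V) : ℕ :=
  (Set.range (color G v)).ncard

/-- The set of numbers of colors that first-fit uses on `G`, over all orders (enumerations
without repetition) of the vertex set. -/
def colorCounts {V : Type*} [Fintype V] (G : SimpleGraph V) : Set ℕ :=
  Set.range fun v : Fin (Fintype.card V) ≃ V => numColors G v

/-- The maximum number of colors that first-fit uses on `G`, over all vertex orders. -/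
noncomputable def chiFF {V : Type*} [Fintype V] (G : SimpleGraph V) : ℕ :=
  sSup (colorCounts G)

/-- The supremum defining `chiFF` is a maximum. -/
theorem isGreatest_chiFF {V : Type*} [Fintype V] (G : SimpleGraph V) :
    IsGreatest (colorCounts G) (chiFF G) := by
  have hfin : (colorCounts G).Finite := Set.finite_range _
  have hne : (colorCounts G).Nonempty := ⟨_, (Fintype.equivFin V).symm, rfl⟩
  exact ⟨Nat.sSup_mem hne hfin.bddAbove, fun _ hx => le_csSup hfin.bddAbove hx⟩

/-- The set in the definition of `color` is nonempty, so that its least element exists. -/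
theorem color_isLeast {V : Type*} (G : SimpleGraph V) {n : ℕ} (v : Fin n → V) (k : Fin n) :
    IsLeast {c : ℕ | 0 < c ∧ ∀ j : Fin n, j < k → G.Adj (v j) (v k) → color G v j ≠ c}
      (color G v k) := by
  have hne : {c : ℕ | 0 < c ∧
      ∀ j : Fin n, j < k → G.Adj (v j) (v k) → color G v j ≠ c}.Nonempty := by
    refine ⟨(∑ j, color G v j) + 1, Nat.succ_pos _, fun j _ _ h => ?_⟩
    have := Finset.single_le_sum (f := color G v) (fun i _ => Nat.zero_le _) (Finset.mem_univ j)
    omega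
  rw [color]
  exact ⟨Nat.sInf_mem hne, fun _ hx => Nat.sInf_le hx⟩

/-- The worst-case performance ratio of first-fit on interval graphs: the supremum of
`χ_FF(G) / ω(G)` over all finite interval graphs `G` with nonempty vertex set. It is taken in the
extended reals, where every set has a supremum. -/
noncomputable def R : EReal :=
  sSup {x : EReal | ∃ (V : Type) (_ : Fintype V) (_ : Nonempty V) (G : SimpleGraph V),
    IsIntervalGraph G ∧ x = (((chiFF G : ℝ) / (G.cliqueNum : ℝ) : ℝ) : EReal)}

end FirstFit

/-!
A wall is a finite row of columns, each a union of intervals of real levels, such that under every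
maximal run of columns containing a level each lower level occurs in some column of the run.
Sampling a wall of width `1` and height `h` at the multiples of `1 / N` turns such runs into
intervals; coloring a run by its level gives a Grundy coloring of their intersection graph with at
least `N * h` colors, whose cliques have at most `N + O(1)` vertices. Hence `h ≤ R`.

Suppose that the heights of walls of width `1` have a supremum `H < 5`, and let `H < r < 5`. By
scaling, giving up an amount `k` of the width costs at most `r * k` of the height. Such narrower
walls and pillars at their sides support further ranges. If pillars can reach `c` times as deep as
a direct construction requires, then they can also reach `1 + c ^ 2 / (r - 1)` times as deep. This
map has no fixed point, because the discriminant `(r - 1) * (r - 5)` is negative, and so iterating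
it makes the ratio arbitrarily large. With a ratio of at least `(r - 1) * (2 * r - 1)` one builds a
wall of width `1` that is taller than `H`, a contradiction.
-/

namespace FirstFit

open Set Filter Topology
open scoped NNReal

/-- A Grundy coloring of `G`, with colors counted from `0`: a proper coloring in which every vertex
has a neighbor in each smaller color. -/
structure IsGrundyColoring {V : Type*} (G : SimpleGraph V) (f : V → ℕ) : Prop where
  ne_of_adj : ∀ ⦃u v⦄, G.Adj u v → f u ≠ f v
  exists_adj : ∀ v, ∀ c < f v, ∃ u, G.Adj u v ∧ f u = c

namespace IsGrundyColoring

variable {V : Type*} {G : SimpleGraph V} {f : V → ℕ}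

theorem color_eq {n : ℕ} (hf : IsGrundyColoring G f) (e : Fin n ≃ V) (he : Monotone (f ∘ e))
    (k : Fin n) : color G e k = f (e k) + 1 := by
  induction k using WellFoundedLT.induction with
  | ind k ih =>
    refine (color_isLeast G e k).unique ⟨⟨Nat.succ_pos _, fun j hj hadj hc => ?_⟩, ?_⟩
    · rw [ih j hj] at hc
      exact hf.ne_of_adj hadj (Nat.succ_injective hc)
    · rintro c ⟨hc0, hc⟩
      by_contra! hlt
      obtain ⟨u, hadj, hu⟩ := hf.exists_adj (e k) (c - 1) (by lia)
      have hearlier : e.symm u < k := he.reflect_lt <| by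
        simp only [Function.comp_apply, e.apply_symm_apply]
        lia
      refine hc (e.symm u) hearlier (by rwa [e.apply_symm_apply]) ?_
      rw [ih _ hearlier, e.apply_symm_apply]
      lia

theorem ncard_range_le_chiFF [Fintype V] (hf : IsGrundyColoring G f) :
    (range f).ncard ≤ chiFF G := by
  let e₀ := (Fintype.equivFin V).symm
  let e := (Tuple.sort (f ∘ e₀)).trans e₀
  have he : Monotone (f ∘ e) := Tuple.monotone_sort (f ∘ e₀)
  have hcolors : range (color G e) = Nat.succ '' range f := by
    rw [← range_comp, ← e.surjective.range_comp]
    exact congrArg range (funext (hf.color_eq e he))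
  calc (range f).ncard = numColors G e := by
        rw [numColors, hcolors, ncard_image_of_injective _ Nat.succ_injective]
    _ ≤ chiFF G := (isGreatest_chiFF G).2 ⟨e, rfl⟩

end IsGrundyColoring

theorem IsIntervalGraph.div_le_R {V : Type} [Fintype V] [Nonempty V] {G : SimpleGraph V}
    (hG : IsIntervalGraph G) {n w : ℕ} (hn : n ≤ chiFF G) (hw : G.cliqueNum ≤ w) :
    ((n / w : ℝ) : EReal) ≤ R := by
  obtain ⟨v⟩ := ‹Nonempty V›
  have hpos : 0 < G.cliqueNum :=
    Nat.lt_of_lt_of_le (by simp) (SimpleGraph.IsClique.card_le_cliqueNum (G := G) (t := {v})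
      (tc := by simp))
  refine le_trans ?_ (le_sSup ⟨V, ‹_›, ⟨v⟩, G, hG, rfl⟩)
  rw [EReal.coe_le_coe_iff]
  gcongr

/-- The intersection graph of a family of sets. -/
def intersectionGraph {V α : Type*} (I : V → Set α) : SimpleGraph V where
  Adj u v := u ≠ v ∧ (I u ∩ I v).Nonempty
  symm := ⟨fun u v h => ⟨h.1.symm, inter_comm (I u) (I v) ▸ h.2⟩⟩
  loopless := ⟨fun _ h => h.1 rfl⟩

section IntersectionGraph

variable {V : Type*} {I : V → Set ℕ}

theorem isIntervalGraph_intersectionGraph (hI : ∀ v, (I v).OrdConnected) :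
    IsIntervalGraph (intersectionGraph I) := by
  refine ⟨fun v => Nat.floor ⁻¹' I v,
    fun v => convex_iff_ordConnected.mpr ((hI v).preimage_mono Nat.floor_mono),
    fun u v => and_congr_right fun _ => ⟨?_, ?_⟩⟩
  · rintro ⟨k, hk⟩
    exact ⟨k, by simpa using hk⟩
  · rintro ⟨t, ht⟩
    exact ⟨⌊t⌋₊, ht⟩

theorem exists_forall_mem_of_pairwise_inter (hI : ∀ v, (I v).OrdConnected) {s : Finset V}
    (hs : ∀ u ∈ s, ∀ v ∈ s, (I u ∩ I v).Nonempty) : ∃ k, ∀ v ∈ s, k ∈ I v := by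
  obtain rfl | hne := s.eq_empty_or_nonempty
  · simp
  obtain ⟨v, hv, hmax⟩ := s.exists_max_image (fun v => sInf (I v)) hne
  refine ⟨sInf (I v), fun u hu => ?_⟩
  obtain ⟨m, hmu, hmv⟩ := hs u hu v hv
  exact (hI u).out (Nat.sInf_mem ⟨m, hmu⟩) hmu ⟨hmax u hu, Nat.sInf_le hmv⟩

theorem cliqueNum_intersectionGraph_le [Finite V] (hI : ∀ v, (I v).OrdConnected)
    (hne : ∀ v, (I v).Nonempty) {w : ℕ} (hw : ∀ k, {v | k ∈ I v}.ncard ≤ w) :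
    (intersectionGraph I).cliqueNum ≤ w := by
  obtain ⟨s, hs⟩ := (intersectionGraph I).exists_isNClique_cliqueNum
  obtain ⟨k, hk⟩ : ∃ k, ∀ v ∈ s, k ∈ I v := by
    refine exists_forall_mem_of_pairwise_inter hI fun u hu v hv => ?_
    obtain rfl | huv := eq_or_ne u v
    · simpa using hne u
    · exact (hs.isClique hu hv huv).2
  rw [← hs.card_eq, ← ncard_coe_finset]
  exact (ncard_le_ncard hk).trans (hw k)

end IntersectionGraph

/-- Let `C x` be the set of columns that contain the level `x`. The family is supported if each
maximal run of consecutive columns containing a level has a column in common with each lower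
level. -/
def IsSupportedFamily {ι : Type*} [LT ι] (C : ι → Set ℕ) : Prop :=
  ∀ ⦃y x⦄, y < x → ∀ i ∈ C x, (ordConnectedComponent (C x) i ∩ C y).Nonempty

/-- The bricks of a family of sets of columns: a brick is a level together with a maximal run of
consecutive columns containing it, which is encoded by a chosen column of the run. -/
abbrev Brick {ι : Type*} (C : ι → Set ℕ) : Type _ :=
  Σ x, ordConnectedSection (C x)

namespace Brick

variable {ι : Type*} {C : ι → Set ℕ}

/-- The set of columns of a brick. -/
def columns (v : Brick C) : Set ℕ := ordConnectedComponent (C v.1) v.2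

theorem mem_of_mem_columns {v : Brick C} {k : ℕ} (hk : k ∈ v.columns) : k ∈ C v.1 :=
  ordConnectedComponent_subset hk

theorem ordConnected_columns (v : Brick C) : v.columns.OrdConnected :=
  inferInstanceAs (ordConnectedComponent _ _).OrdConnected

theorem nonempty_columns (v : Brick C) : v.columns.Nonempty :=
  nonempty_ordConnectedComponent.mpr (ordConnectedSection_subset v.2.2)

theorem eq_of_mem_columns {u v : Brick C} (h : u.1 = v.1) {k : ℕ} (hu : k ∈ u.columns)
    (hv : k ∈ v.columns) : u = v := by
  obtain ⟨x, i, hi⟩ := u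
  obtain ⟨y, j, hj⟩ := v
  obtain rfl : x = y := h
  have hij : j ∈ ordConnectedComponent (C x) i :=
    mem_ordConnectedComponent_trans hu (mem_ordConnectedComponent_comm.mp hv)
  obtain rfl := eq_of_mem_ordConnectedSection_of_uIcc_subset hi hj hij
  rfl

theorem exists_mem_columns {x : ι} {k : ℕ} (hk : k ∈ C x) :
    ∃ v : Brick C, v.1 = x ∧ k ∈ v.columns :=
  ⟨⟨x, ordConnectedProj (C x) ⟨k, hk⟩, mem_range_self _⟩, rfl,
    mem_ordConnectedComponent_ordConnectedProj (C x) ⟨k, hk⟩⟩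

theorem finite [Finite ι] (hC : ∀ x, (C x).Finite) : Finite (Brick C) :=
  have (x : ι) : Finite (ordConnectedSection (C x)) :=
    (hC x).subset ordConnectedSection_subset
  inferInstance

theorem ncard_mem_columns_le [Finite ι] (k : ℕ) :
    {v : Brick C | k ∈ v.columns}.ncard ≤ {x | k ∈ C x}.ncard :=
  ncard_le_ncard_of_injOn Sigma.fst (fun _ => mem_of_mem_columns)
    fun _ hu _ hv h => eq_of_mem_columns h hu hv

theorem isGrundyColoring {n : ℕ} {C : Fin n → Set ℕ} (hC : IsSupportedFamily C) :
    IsGrundyColoring (intersectionGraph (columns (C := C))) fun v => v.1 where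
  ne_of_adj := by
    rintro u v ⟨hne, k, hu, hv⟩ h
    exact hne (eq_of_mem_columns (Fin.ext h) hu hv)
  exists_adj := by
    intro v c hc
    let x : Fin n := ⟨c, hc.trans v.1.2⟩
    obtain ⟨k, hkv, hkx⟩ := hC (y := x) hc v.2 (ordConnectedSection_subset v.2.2)
    obtain ⟨u, hux, hku⟩ := exists_mem_columns hkx
    have hu : (u.1 : ℕ) = c := congrArg Fin.val hux
    exact ⟨u, ⟨fun huv => hc.ne (huv ▸ hu.symm), k, hku, hkv⟩, hu⟩

end Brick

theorem IsSupportedFamily.div_le_R {n w : ℕ} [NeZero n] {C : Fin n → Set ℕ}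
    (hC : IsSupportedFamily C) (hfin : ∀ x, (C x).Finite) (hne : ∀ x, (C x).Nonempty)
    (hw : ∀ k, {x | k ∈ C x}.ncard ≤ w) : ((n / w : ℝ) : EReal) ≤ R := by
  have := Brick.finite hfin
  let _ := Fintype.ofFinite (Brick C)
  have hlevel (x : Fin n) : ∃ v : Brick C, v.1 = x :=
    (Brick.exists_mem_columns (hne x).some_mem).imp fun _ => And.left
  have : Nonempty (Brick C) := ⟨(hlevel 0).choose⟩
  refine (isIntervalGraph_intersectionGraph Brick.ordConnected_columns).div_le_R ?_
    (cliqueNum_intersectionGraph_le Brick.ordConnected_columns Brick.nonempty_columns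
      fun k => (Brick.ncard_mem_columns_le k).trans (hw k))
  calc n = (range (Fin.val : Fin n → ℕ)).ncard := by
        rw [← image_univ, ncard_image_of_injective _ Fin.val_injective, ncard_univ, Nat.card_fin]
    _ = (range fun v : Brick C => (v.1 : ℕ)).ncard := by
        rw [← Function.Surjective.range_comp hlevel]
        rfl
    _ ≤ _ := (Brick.isGrundyColoring hC).ncard_range_le_chiFF

theorem natCeil_sub_natCeil_le (a b : ℝ) : ((⌈b⌉₊ - ⌈a⌉₊ : ℕ) : ℝ) ≤ max (b - a) 0 + 1 := by
  have hceil : ⌈b⌉₊ - ⌈a⌉₊ ≤ ⌈max (b - a) 0⌉₊ :=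
    Nat.sub_le_iff_le_add'.mpr <|
      (Nat.ceil_mono (by linarith [le_max_left (b - a) 0])).trans (Nat.ceil_add_le _ _)
  exact (Nat.cast_le.mpr hceil).trans (Nat.ceil_lt_add_one (le_max_right _ _)).le

/-- A column of a wall, as a finite list of ranges of levels: `(a, b)` stands for `[a, b)`. -/
abbrev Column : Type := List (ℝ × ℝ)

namespace Column

/-- The set of levels of a column. -/
def levels (S : Column) : Set ℝ := {x | ∃ p ∈ S, x ∈ Ico p.1 p.2}

/-- The total length of the ranges of a column. -/
def size (S : Column) : ℝ := (S.map fun p => max (p.2 - p.1) 0).sum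

@[simp] theorem levels_nil : levels [] = ∅ := by
  simp [levels]

@[simp] theorem levels_cons (p : ℝ × ℝ) (S : Column) :
    levels (p :: S) = Ico p.1 p.2 ∪ levels S := by
  ext x
  simp [levels]

@[simp] theorem size_nil : size [] = 0 := rfl

theorem size_cons (p : ℝ × ℝ) (S : Column) : size (p :: S) = max (p.2 - p.1) 0 + size S := rfl

/-- The column with all levels multiplied by `t`. -/
def scale (t : ℝ) (S : Column) : Column := S.map fun p => (t * p.1, t * p.2)

theorem mem_levels_scale {t : ℝ} (ht : 0 < t) {S : Column} {x : ℝ} :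
    x ∈ levels (scale t S) ↔ x / t ∈ levels S := by
  simp [levels, scale, le_div_iff₀' ht, div_lt_iff₀' ht]

theorem size_scale {t : ℝ} (ht : 0 ≤ t) (S : Column) : size (scale t S) = t * size S := by
  simp only [size, scale, List.map_map, ← List.sum_map_mul_left]
  congr! 2
  ext p
  simp [mul_max_of_nonneg, ht, mul_sub]

theorem finite_natCast_mem_levels (S : Column) : {m : ℕ | (m : ℝ) ∈ levels S}.Finite := by
  induction S with
  | nil => simp
  | cons p S ih =>
    rw [levels_cons]
    exact (Nat.preimage_Ico (a := p.1) ▸ finite_Ico ⌈p.1⌉₊ ⌈p.2⌉₊).union ih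

theorem ncard_natCast_mem_levels_le (S : Column) :
    ({m : ℕ | (m : ℝ) ∈ levels S}.ncard : ℝ) ≤ size S + S.length := by
  induction S with
  | nil => simp
  | cons p S ih =>
    have hsplit : {m : ℕ | (m : ℝ) ∈ levels (p :: S)} =
        Ico ⌈p.1⌉₊ ⌈p.2⌉₊ ∪ {m : ℕ | (m : ℝ) ∈ levels S} := by
      rw [levels_cons, ← Nat.preimage_Ico]
      rfl
    have hcard := ncard_union_le (Ico ⌈p.1⌉₊ ⌈p.2⌉₊) {m : ℕ | (m : ℝ) ∈ levels S}
    rw [← hsplit, ← Finset.coe_Ico, ncard_coe_finset, Nat.card_Ico] at hcard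
    rw [size_cons, List.length_cons, Nat.cast_succ]
    linarith [Nat.cast_le (α := ℝ).mpr hcard, natCeil_sub_natCeil_le p.1 p.2,
      Nat.cast_add (R := ℝ) (⌈p.2⌉₊ - ⌈p.1⌉₊) {m : ℕ | (m : ℝ) ∈ levels S}.ncard]

end Column

open Column

/-- The set of indices of the columns of `L` that contain the level `x`. -/
def columnsAt (L : List Column) (x : ℝ) : Set ℕ := {i | ∃ S ∈ L[i]?, x ∈ levels S}

section ColumnsAt

variable {L A B : List Column} {x : ℝ} {i : ℕ}

theorem lt_length_of_mem_columnsAt (hi : i ∈ columnsAt L x) : i < L.length := by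
  obtain ⟨S, hS, -⟩ := hi
  exact (List.getElem?_eq_some_iff.mp hS).1

theorem nonempty_columnsAt : (columnsAt L x).Nonempty ↔ ∃ S ∈ L, x ∈ levels S := by
  constructor
  · rintro ⟨i, S, hS, hx⟩
    exact ⟨S, List.mem_of_getElem? hS, hx⟩
  · rintro ⟨S, hS, hx⟩
    obtain ⟨i, hi⟩ := List.getElem?_of_mem hS
    exact ⟨i, S, hi, hx⟩

theorem mem_columnsAt_append :
    i ∈ columnsAt (A ++ B) x ↔ i ∈ columnsAt A x ∨ A.length ≤ i ∧ i - A.length ∈ columnsAt B x := by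
  unfold columnsAt
  rcases lt_or_ge i A.length with h | h
  · simp [List.getElem?_append_left h, Nat.not_le.mpr h]
  · simp [List.getElem?_append_right h, h]

theorem mem_columnsAt_reverse (hi : i < L.length) :
    i ∈ columnsAt L.reverse x ↔ L.length - 1 - i ∈ columnsAt L x := by
  simp [columnsAt, List.getElem?_reverse hi]

theorem mem_columnsAt_map_cons {p : ℝ × ℝ} :
    i ∈ columnsAt (L.map (p :: ·)) x ↔
      i ∈ columnsAt L x ∨ i < L.length ∧ x ∈ Ico p.1 p.2 := by
  rcases lt_or_ge i L.length with h | h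
  · simp [columnsAt, h, or_comm]
  · simp [columnsAt, Nat.not_lt.mpr h]

theorem columnsAt_map_scale {t : ℝ} (ht : 0 < t) :
    columnsAt (L.map (scale t)) x = columnsAt L (x / t) := by
  ext i
  simp [columnsAt, mem_levels_scale ht]

end ColumnsAt

/-- The columns form a supported family when all levels `x ≥ 0` are considered; negative levels are
disregarded. -/
def IsSupported (L : List Column) : Prop := IsSupportedFamily fun x : ℝ≥0 => columnsAt L x

namespace IsSupported

variable {L A B : List Column}

theorem of_forall_eq_nil (hL : ∀ S ∈ L, S = []) : IsSupported L := by
  intro y x _ i hi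
  obtain ⟨S, hS, hx⟩ := nonempty_columnsAt.mp ⟨i, hi⟩
  simp [hL S hS] at hx

theorem append (hA : IsSupported A) (hB : IsSupported B) : IsSupported (A ++ B) := by
  intro y x hyx i hi
  rcases mem_columnsAt_append.mp hi with hi | ⟨hAi, hi⟩
  · obtain ⟨k, hrun, hk⟩ := hA hyx i hi
    exact ⟨k, fun m hm => mem_columnsAt_append.mpr (Or.inl (hrun hm)),
      mem_columnsAt_append.mpr (Or.inl hk)⟩
  · obtain ⟨k, hrun, hk⟩ := hB hyx _ hi
    refine ⟨k + A.length, fun m hm => mem_columnsAt_append.mpr (Or.inr ?_),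
      mem_columnsAt_append.mpr (Or.inr ⟨by lia, by simpa using hk⟩)⟩
    rw [mem_uIcc] at hm
    exact ⟨by lia, hrun (mem_uIcc.mpr (by lia))⟩

theorem reverse (hL : IsSupported L) : IsSupported L.reverse := by
  intro y x hyx i hi
  have hiL : i < L.length := by simpa using lt_length_of_mem_columnsAt hi
  obtain ⟨k, hrun, hk⟩ := hL hyx _ ((mem_columnsAt_reverse hiL).mp hi)
  have hkL := lt_length_of_mem_columnsAt hk
  refine ⟨L.length - 1 - k, fun m hm => ?_, (mem_columnsAt_reverse (by lia)).mpr ?_⟩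
  · rw [mem_uIcc] at hm
    exact (mem_columnsAt_reverse (by lia)).mpr (hrun (mem_uIcc.mpr (by lia)))
  · rwa [show L.length - 1 - (L.length - 1 - k) = k by lia]

theorem map_scale {t : ℝ} (ht : 0 < t) (hL : IsSupported L) : IsSupported (L.map (scale t)) := by
  intro y x hyx i hi
  lift t to ℝ≥0 using ht.le
  simp only [columnsAt_map_scale ht, ← NNReal.coe_div] at hi ⊢
  exact hL (by gcongr) i hi

theorem map_cons {G D : List Column} (h : IsSupported (A ++ G ++ D)) (p : ℝ × ℝ)
    (hp : ∀ y : ℝ≥0, y < p.1 → ∃ S ∈ G, (y : ℝ) ∈ levels S) :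
    IsSupported (A ++ G.map (p :: ·) ++ D) := by
  have hmem (i : ℕ) (x : ℝ) : i ∈ columnsAt (A ++ G.map (p :: ·) ++ D) x ↔
      i ∈ columnsAt (A ++ G ++ D) x ∨
        i ∈ Ico A.length (A.length + G.length) ∧ x ∈ Ico p.1 p.2 := by
    have : i - A.length < G.length ∧ A.length ≤ i ↔
        i ∈ Ico A.length (A.length + G.length) := by
      rw [mem_Ico]
      lia
    simp only [mem_columnsAt_append, mem_columnsAt_map_cons, List.length_append, List.length_map]
    tauto
  intro y x hyx i hi
  rcases (hmem i x).mp hi with hi' | ⟨hiG, hx⟩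
  · obtain ⟨k, hrun, hk⟩ := h hyx i hi'
    exact ⟨k, fun m hm => (hmem m x).mpr (Or.inl (hrun hm)), (hmem k y).mpr (Or.inl hk)⟩
  by_cases hpy : p.1 ≤ y
  · exact ⟨i, self_mem_ordConnectedComponent.mpr hi,
      (hmem i y).mpr (Or.inr ⟨hiG, hpy, lt_trans (NNReal.coe_lt_coe.mpr hyx) hx.2⟩)⟩
  · obtain ⟨j, hj⟩ := nonempty_columnsAt.mpr (hp y (not_le.mp hpy))
    have hjG := lt_length_of_mem_columnsAt hj
    have hjAG : A.length + j ∈ columnsAt (A ++ G) y :=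
      mem_columnsAt_append.mpr (Or.inr ⟨by lia, by simpa using hj⟩)
    refine ⟨A.length + j, fun m hm => (hmem m x).mpr (Or.inr ⟨?_, hx⟩),
      (hmem _ y).mpr (Or.inl (mem_columnsAt_append.mpr (Or.inl hjAG)))⟩
    rw [mem_uIcc] at hm
    rw [mem_Ico] at hiG ⊢
    lia

end IsSupported

/-- The list `L` is a wall of width `w` and height `h`: it is supported, no column has size more
than `w`, and every level in `[0, h)` is present. -/
structure IsWall (L : List Column) (w h : ℝ) : Prop where
  supported : IsSupported L
  size_le : ∀ S ∈ L, size S ≤ w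
  exists_mem : ∀ y : ℝ≥0, y < h → ∃ S ∈ L, (y : ℝ) ∈ levels S

/-- There is a wall of width `w` and height `h`. -/
def HasWall (w h : ℝ) : Prop := ∃ L, IsWall L w h

theorem IsWall.map_scale {L : List Column} {w h t : ℝ} (hL : IsWall L w h) (ht : 0 < t) :
    IsWall (L.map (scale t)) (t * w) (t * h) where
  supported := hL.supported.map_scale ht
  size_le := by
    simp only [List.forall_mem_map, size_scale ht.le]
    intro S hS
    have := hL.size_le S hS
    gcongr
  exists_mem := by
    intro y hy
    lift t to ℝ≥0 using ht.le
    obtain ⟨S, hS, hyS⟩ := hL.exists_mem (y / t) (by simpa using (div_lt_iff₀' ht).mpr hy)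
    exact ⟨scale t S, List.mem_map_of_mem hS, (mem_levels_scale ht).mpr hyS⟩

namespace HasWall

variable {w h : ℝ}

theorem mono_height (hw : HasWall w h) {h' : ℝ} (hh : h' ≤ h) : HasWall w h' := by
  obtain ⟨L, hL⟩ := hw
  exact ⟨L, hL.supported, hL.size_le, fun y hy => hL.exists_mem y (hy.trans_le hh)⟩

theorem of_nonpos (hh : h ≤ 0) : HasWall w h :=
  ⟨[], .of_forall_eq_nil (by simp), by simp,
    fun y hy => absurd (hy.trans_le hh) (not_lt.mpr y.2)⟩

theorem scale (hw : HasWall w h) {t : ℝ} (ht : 0 < t) : HasWall (t * w) (t * h) := by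
  obtain ⟨L, hL⟩ := hw
  exact ⟨_, hL.map_scale ht⟩

end HasWall

/-- There is a supported list of columns with a distinguished column, its pivot, such that the
pivot has size at most `wp` and contains all levels in `[a, b)`, the columns to its left have size
at most `wl`, and those to its right have size at most `wr`. -/
def HasPillar (a b wl wp wr : ℝ) : Prop :=
  ∃ (A : List Column) (P : Column) (B : List Column), IsSupported (A ++ P :: B) ∧
    Ico a b ⊆ levels P ∧ (∀ S ∈ A, size S ≤ wl) ∧ size P ≤ wp ∧ ∀ S ∈ B, size S ≤ wr

namespace HasPillar

variable {a b wl wp wr : ℝ}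

theorem mono (h : HasPillar a b wl wp wr) {a' b' wl' wp' wr' : ℝ} (ha : a ≤ a') (hb : b' ≤ b)
    (hl : wl ≤ wl') (hp : wp ≤ wp') (hr : wr ≤ wr') : HasPillar a' b' wl' wp' wr' := by
  obtain ⟨A, P, B, hsup, hP, hAl, hPp, hBr⟩ := h
  exact ⟨A, P, B, hsup, (Ico_subset_Ico ha hb).trans hP, fun S hS => (hAl S hS).trans hl,
    hPp.trans hp, fun S hS => (hBr S hS).trans hr⟩

theorem symm (h : HasPillar a b wl wp wr) : HasPillar a b wr wp wl := by
  obtain ⟨A, P, B, hsup, hP, hAl, hPp, hBr⟩ := h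
  exact ⟨B.reverse, P, A.reverse, by simpa using hsup.reverse, hP, by simpa using hBr, hPp,
    by simpa using hAl⟩

theorem of_le (hba : b ≤ a) (hp : 0 ≤ wp) : HasPillar a b wl wp wr :=
  ⟨[], [], [], .of_forall_eq_nil (by simp), by simp [hba], by simp, hp, by simp⟩

theorem hasWall (h : HasPillar a b wl wp wr) (hab : a < b) {w : ℝ} (hl : wl ≤ w)
    (hp : wp ≤ w) (hr : wr ≤ w) : HasWall w b := by
  obtain ⟨A, P, B, hsup, hP, hAl, hPp, hBr⟩ := h
  refine ⟨A ++ P :: B, hsup, ?_, fun y hy => ?_⟩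
  · simp only [List.mem_append, List.mem_cons]
    rintro S (hS | rfl | hS)
    exacts [(hAl S hS).trans hl, hPp.trans hp, (hBr S hS).trans hr]
  · by_cases hya : a ≤ y
    · exact ⟨P, by simp, hP ⟨hya, hy⟩⟩
    · have ha : 0 ≤ a := y.2.trans (not_le.mp hya).le
      lift a to ℝ≥0 using ha
      obtain ⟨i, hi⟩ : (columnsAt (A ++ P :: B) a).Nonempty :=
        nonempty_columnsAt.mpr ⟨P, by simp, hP ⟨le_rfl, hab⟩⟩
      obtain ⟨k, -, hk⟩ := hsup (NNReal.coe_lt_coe.mp (not_le.mp hya)) i hi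
      exact nonempty_columnsAt.mp ⟨k, hk⟩

/-- The new range `[c, c + t)` is laid across the pivots of the two pillars, the wall between them
and all columns on the inner sides of the pillars. Below it, the wall provides the levels up to `a`,
the left pivot those from `a` to `b`, and the right pivot those from `b` to `c`. -/
theorem bridge {c w t : ℝ} (hleft : HasPillar a b wl wp w) (hwall : HasWall w a)
    (hright : HasPillar b c w w wr) (ht : 0 ≤ t) (hr : t + w ≤ wr) :
    HasPillar c (c + t) wl (t + wp) wr := by
  obtain ⟨A, P, B, hsup, hP, hAl, hPp, hBr⟩ := hleft
  obtain ⟨W, hW⟩ := hwall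
  obtain ⟨A', P', B', hsup', hP', hAl', hPp', hBr'⟩ := hright
  have hsize (S : Column) : size ((c, c + t) :: S) = t + size S := by simp [size_cons, ht]
  have hsupport := IsSupported.map_cons (A := A) (G := P :: (B ++ W ++ A' ++ [P'])) (D := B')
    (by simpa using (hsup.append hW.supported).append hsup') (c, c + t) (by
      intro y hyc
      by_cases hya : y < a
      · obtain ⟨S, hS, hy⟩ := hW.exists_mem y hya
        exact ⟨S, by simp [hS], hy⟩
      by_cases hyb : y < b
      · exact ⟨P, by simp, hP ⟨not_lt.mp hya, hyb⟩⟩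
      · exact ⟨P', by simp, hP' ⟨not_lt.mp hyb, hyc⟩⟩)
  refine ⟨A, (c, c + t) :: P, (B ++ W ++ A' ++ [P']).map ((c, c + t) :: ·) ++ B',
    by simpa using hsupport, by simp, hAl, (hsize P).trans_le (by gcongr), fun S hS => ?_⟩
  rcases List.mem_append.mp hS with hS | hS
  · obtain ⟨T, hT, rfl⟩ := List.mem_map.mp hS
    have hTw : size T ≤ w := by
      simp only [List.mem_append, List.mem_singleton] at hT
      rcases hT with ((hT | hT) | hT) | rfl
      exacts [hBr T hT, hW.size_le T hT, hAl' T hT, hPp']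
    linarith [hsize T]
  · exact hBr' S hS

theorem bridge_right {c w t : ℝ} (hwall : HasWall w a)
    (hright : HasPillar a c w w wr) (ht : 0 ≤ t) (hr : t + w ≤ wr) :
    HasPillar c (c + t) wl t wr := by
  simpa using bridge (of_le le_rfl le_rfl) hwall hright ht hr

end HasPillar

theorem hasWall_one_one : HasWall 1 1 := by
  have hground : HasPillar 0 (0 + 1) 0 1 1 :=
    .bridge_right (.of_nonpos le_rfl) (.of_le le_rfl le_rfl) zero_le_one (by norm_num)
  simpa using hground.hasWall (by norm_num) zero_le_one le_rfl le_rfl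

/-- For every `k ∈ (0, 1]`, decreasing the width from `1` to `1 - k` costs at most `r * k` of the
height `H`. -/
def HasNarrowWalls (H r : ℝ) : Prop :=
  ∀ k, 0 < k → k ≤ 1 → HasWall (1 - k) (H - r * k)

theorem hasNarrowWalls_of_lt {H r : ℝ} (hH : ∀ h < H, HasWall 1 h) (hr : H < r) :
    HasNarrowWalls H r := by
  intro k hk hk1
  have hHk : H * k < r * k := by gcongr
  rcases hk1.eq_or_lt with rfl | hk1
  · exact .of_nonpos (by linarith)
  have hk1' : 0 < 1 - k := by linarith
  have hlt : (H - r * k) / (1 - k) < H := by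
    rw [div_lt_iff₀ hk1']
    linarith
  simpa [mul_div_cancel₀ _ hk1'.ne'] using (hH _ hlt).scale hk1'

/-- Pillars can multiply depths by `c`. Suppose that ranges of total size `α` are in use on both
sides of a line, and further ones of size `β` on its left side. Depths are measured downwards from
the height `H`, and these ranges account for the depth `r * α + β`. Then a pillar on the line
provides all depths that exceed `r * α + β` by between `x` and `c * x`, with a pivot whose size is
at most `K` times `α + β + x`. -/
structure IsPillarRatio (H r c K : ℝ) : Prop where
  nonneg : 0 ≤ K
  hasPillar : ∀ ⦃α β x⦄, 0 ≤ α → 0 ≤ β → 0 < x → K * (α + β + x) ≤ 1 →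
    HasPillar (H - (r * α + β + c * x)) (H - (r * α + β + x))
      (1 - (α + β)) (K * (α + β + x)) (1 - α)

theorem isPillarRatio_one (H r : ℝ) : IsPillarRatio H r 1 0 where
  nonneg := le_rfl
  hasPillar _ _ _ _ _ _ _ := .of_le (by rw [one_mul]) (by simp)

namespace IsPillarRatio

variable {H r c K : ℝ}

theorem hasPillar_inner (h : IsPillarRatio H r c K) (hr : 1 < r) (hc : 0 < c)
    (hrc : (r - 1) * (c - 1) ≤ c ^ 2) {α β b x : ℝ} (hα : 0 ≤ α) (hβ : 0 ≤ β) (hx : 0 < x)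
    (hb : (r - 1) * b = c ^ 2 * x) (hsmall : K * (α + b + c * (β + x)) ≤ 1) :
    HasPillar (H - r * (α + b)) (H - (r * α + b + c * (β + x)))
      (1 - (α + β)) (K * (α + b + c * (β + x))) (1 - (α + b)) := by
  have hr1 : 0 < r - 1 := by linarith
  have hb0 : 0 < b := pos_of_mul_pos_right (hb ▸ by positivity) hr1.le
  have hK := h.nonneg
  by_cases hdeep : (r - 1) * b ≤ c * (β + x)
  · exact .of_le (by linarith) (by positivity)
  have hβx : β < (c - 1) * x := by
    have : c * (β + x) < c * (c * x) := by linarith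
    linarith [lt_of_mul_lt_mul_left this hc.le]
  have hβb : β < b := by
    have hlt : (r - 1) * β < (r - 1) * ((c - 1) * x) := by gcongr
    have hle : (r - 1) * (c - 1) * x ≤ c ^ 2 * x := by gcongr
    exact lt_of_mul_lt_mul_left (by linarith) hr1.le
  -- `y` is chosen so that the inner pillar ends at the depth `r * α + b + c * (β + x)`.
  set y := c * (β + x) - (r - 1) * β with hy
  have hcy : (r - 1) * (b - β) ≤ c * y := by
    have : (r - 1) * (c - 1) * β ≤ c ^ 2 * β := by gcongr
    rw [hy]
    linarith
  have hy0 : 0 < y :=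
    pos_of_mul_pos_right ((mul_pos hr1 (sub_pos.mpr hβb)).trans_le hcy) hc.le
  have hrβ : 0 ≤ (r - 1) * β := by positivity
  have hsize : K * (α + β + (b - β) + y) ≤ K * (α + b + c * (β + x)) :=
    mul_le_mul_of_nonneg_left (by linarith) hK
  exact (h.hasPillar (add_nonneg hα hβ) (sub_pos.mpr hβb).le hy0 (hsize.trans hsmall)).symm.mono
    (by linarith) (by linarith) (by linarith) hsize (by linarith)

/-- The new range has length `b = c ^ 2 / (r - 1) * x`. The pillar at its right end covers the
depths from its lower edge down to `c * (β + x)` beyond `r * α + b`, and the inner pillar takes over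
from there down to `r * (α + b)`, where the wall of width `1 - (α + b)` begins. -/
theorem step (h : IsPillarRatio H r c K) (hr : 1 < r) (hc : 1 ≤ c)
    (hrc : (r - 1) * (c - 1) ≤ c ^ 2) (hW : HasNarrowWalls H r) :
    IsPillarRatio H r (1 + c ^ 2 / (r - 1)) ((K + 1) * (1 + c + c ^ 2 / (r - 1))) := by
  have hr1 : 0 < r - 1 := by linarith
  have hK := h.nonneg
  set e := c ^ 2 / (r - 1) with he
  have : 0 < e := by positivity
  refine ⟨by positivity, fun α β x hα hβ hx hsmall => ?_⟩
  have hb : (r - 1) * (e * x) = c ^ 2 * x := by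
    rw [he]
    field_simp
  set b := e * x
  set m := α + b + c * (β + x) with hm
  have hb0 : 0 < b := by positivity
  have hβx : β + x ≤ c * (β + x) := le_mul_of_one_le_left (by positivity) hc
  have hm_le : m ≤ (1 + c + e) * (α + β + x) := by
    have : 0 ≤ c * α + e * (α + β) + (α + β + x) - α := by
      have : 0 ≤ c * α := by positivity
      have : 0 ≤ e * (α + β) := by positivity
      linarith
    rw [hm]
    linarith
  have hKm : (K + 1) * m ≤ (K + 1) * (1 + c + e) * (α + β + x) := by
    rw [mul_assoc]
    gcongr
  have hKm1 : K * (α + b + (β + x)) ≤ K * m :=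
    mul_le_mul_of_nonneg_left (by linarith) hK
  have : 0 ≤ m := by positivity
  have hKm0 : 0 ≤ K * m := by positivity
  have hright := h.hasPillar hα hb0.le (by positivity : 0 < β + x) (by linarith)
  have hinner := h.hasPillar_inner hr (by linarith) hrc hα hβ hx hb (by linarith)
  have hwall := hW (α + b) (by positivity) (by linarith)
  exact (hinner.bridge hwall (hright.mono le_rfl le_rfl le_rfl (by linarith) le_rfl)
    hb0.le (by linarith)).mono (by linarith) (by linarith) le_rfl (by linarith) le_rfl

theorem exists_ge (hr : 1 < r) (hr5 : r < 5) (hW : HasNarrowWalls H r) (a : ℝ) :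
    ∃ c K, a ≤ c ∧ IsPillarRatio H r c K := by
  have hr1 : 0 < r - 1 := by linarith
  have hr5' : 0 < (5 - r) / 4 := by linarith
  have hgrow (c : ℝ) : c + (5 - r) / 4 ≤ 1 + c ^ 2 / (r - 1) := by
    have hsq : 1 + c ^ 2 / (r - 1) - (c + (5 - r) / 4) = (c - (r - 1) / 2) ^ 2 / (r - 1) := by
      field_simp
      ring
    have : 0 ≤ (c - (r - 1) / 2) ^ 2 / (r - 1) := by positivity
    linarith
  have hiterate (n : ℕ) : ∃ c K, 1 + n * ((5 - r) / 4) ≤ c ∧ IsPillarRatio H r c K := by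
    induction n with
    | zero => exact ⟨1, 0, by simp, isPillarRatio_one H r⟩
    | succ n ih =>
      obtain ⟨c, K, hnc, h⟩ := ih
      have hc : 1 ≤ c := le_trans (le_add_of_nonneg_right (by positivity)) hnc
      have hrc : (r - 1) * (c - 1) ≤ c ^ 2 :=
        (le_div_iff₀' hr1).mp (by linarith [hgrow c])
      refine ⟨_, _, le_trans ?_ (hgrow c), h.step hr hc hrc hW⟩
      push_cast
      linarith
  obtain ⟨n, hn⟩ := exists_nat_ge (a / ((5 - r) / 4))
  obtain ⟨c, K, hnc, h⟩ := hiterate n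
  refine ⟨c, K, ?_, h⟩
  rw [div_le_iff₀ hr5'] at hn
  linarith

/-- A first range, of the depths from `j` to `2 * r * j`, leans on a pillar. A second one, from `j`
below the height `H` to `j` above it, leans on the first, and the wall that it also needs
begins where the first range ends. -/
theorem exists_hasWall_one_gt (h : IsPillarRatio H r c K) (hr : 1 < r)
    (hc : (r - 1) * (2 * r - 1) ≤ c) (hW : HasNarrowWalls H r) : ∃ h > H, HasWall 1 h := by
  have hK := h.nonneg
  obtain ⟨j, hj, hjK⟩ : ∃ j > 0, (K + 1) * ((2 * r + 1) * j) = 1 :=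
    ⟨1 / ((K + 1) * (2 * r + 1)), by positivity, by field_simp⟩
  have hrj : j < r * j := lt_mul_of_one_lt_left hj hr
  have hKrj : 0 ≤ K * (r * j) := by positivity
  have hKj : 0 ≤ K * j := by positivity
  obtain ⟨b, hbj⟩ : ∃ b, b + j = 2 * (r * j) := ⟨_, sub_add_cancel _ _⟩
  have hcj : r * b ≤ b + c * j := by
    have : (r - 1) * (2 * r - 1) * j ≤ c * j := by gcongr
    rw [eq_sub_of_add_eq hbj]
    linarith
  have hpillar := h.hasPillar le_rfl (by linarith : 0 ≤ b) hj
    (by rw [zero_add, hbj]; linarith)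
  simp only [mul_zero, zero_add, sub_zero, hbj] at hpillar
  have hfirst : HasPillar (H - 2 * (r * j)) (H - j) 0 b 1 :=
    (HasPillar.bridge_right (hW b (by linarith) (by linarith))
      (hpillar.mono (by linarith) le_rfl le_rfl (by linarith) le_rfl) (by linarith)
      (by linarith)).mono le_rfl (by linarith) le_rfl le_rfl le_rfl
  have hsecond : HasPillar (H - j) (H - j + 2 * j) 0 (2 * j) 1 :=
    HasPillar.bridge_right (hW (2 * j) (by linarith) (by linarith))
      (hfirst.mono (by linarith) le_rfl (by linarith) (by linarith) le_rfl) (by linarith)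
      (by linarith)
  exact ⟨_, by linarith,
    hsecond.hasWall (by linarith) zero_le_one (by linarith) le_rfl⟩

end IsPillarRatio

theorem hasWall_one_of_lt_five {h : ℝ} (hh : h < 5) : HasWall 1 h := by
  by_contra hno
  set heights : Set ℝ := {h' | HasWall 1 h'}
  have hbound : h ∈ upperBounds heights := fun h' hh' =>
    le_of_not_ge fun hle => hno (hh'.mono_height hle)
  have hlub : IsLUB heights (sSup heights) := isLUB_csSup ⟨1, hasWall_one_one⟩ ⟨h, hbound⟩
  set H := sSup heights
  have hH1 : 1 ≤ H := hlub.1 hasWall_one_one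
  have hH5 : H < 5 := (hlub.2 hbound).trans_lt hh
  have hbelow : ∀ h' < H, HasWall 1 h' := fun h' hlt => by
    obtain ⟨h'', hh'', hlt', -⟩ := hlub.exists_between hlt
    exact hh''.mono_height hlt'.le
  obtain ⟨r, hHr, hr5⟩ := exists_between hH5
  have hr : 1 < r := hH1.trans_lt hHr
  have hW : HasNarrowWalls H r := hasNarrowWalls_of_lt hbelow hHr
  obtain ⟨c, K, hc, hratio⟩ := IsPillarRatio.exists_ge hr hr5 hW ((r - 1) * (2 * r - 1))
  obtain ⟨h', hlt, hh'⟩ := hratio.exists_hasWall_one_gt hr hc hW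
  exact (hlub.1 hh').not_gt hlt

namespace IsWall

variable {L : List Column}

theorem natCeil_div_le_R {w : ℕ} {h : ℝ} (hL : IsWall L w h) (hh : 0 < h) :
    ((⌈h⌉₊ / (w + (L.map List.length).sum : ℕ) : ℝ) : EReal) ≤ R := by
  have : NeZero ⌈h⌉₊ := ⟨(Nat.ceil_pos.mpr hh).ne'⟩
  let C (m : Fin ⌈h⌉₊) : Set ℕ := columnsAt L (m : ℝ≥0)
  have hC : IsSupportedFamily C := fun m m' hm => hL.supported (by simpa using hm)
  refine hC.div_le_R (fun m => (finite_lt_nat L.length).subset fun i =>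
    lt_length_of_mem_columnsAt) (fun m => ?_) fun k => ?_
  · exact nonempty_columnsAt.mpr (hL.exists_mem m (by simpa using Nat.lt_ceil.mp m.2))
  obtain hk | ⟨m₀, S, hS, -⟩ := {m | k ∈ C m}.eq_empty_or_nonempty
  · simp [hk]
  have hSL : S ∈ L := List.mem_of_getElem? hS
  have hsub : MapsTo Fin.val {m | k ∈ C m} {m : ℕ | (m : ℝ) ∈ levels S} := by
    rintro m ⟨T, hT, hm⟩
    obtain rfl : T = S := Option.mem_unique hT hS
    simpa using hm
  have hcard := ncard_le_ncard_of_injOn _ hsub Fin.val_injective.injOn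
    (finite_natCast_mem_levels S)
  have hlength : S.length ≤ (L.map List.length).sum :=
    List.le_sum_of_mem (List.mem_map_of_mem hSL)
  have hcount : ({m : ℕ | (m : ℝ) ∈ levels S}.ncard : ℝ) ≤ w + S.length :=
    (ncard_natCast_mem_levels_le S).trans (by linarith [hL.size_le S hSL])
  exact hcard.trans ((Nat.cast_le.mp (by exact_mod_cast hcount)).trans (by lia))

theorem le_R {h : ℝ} (hL : IsWall L 1 h) (hh : 0 < h) : (h : EReal) ≤ R := by
  set B := (L.map List.length).sum with hB
  have hlim : Tendsto (fun N : ℕ => h * ((N : ℝ) / (N + B))) atTop (𝓝 h) := by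
    simpa using (tendsto_natCast_div_add_atTop (B : ℝ)).const_mul h
  refine le_of_tendsto ((continuous_coe_real_ereal.tendsto h).comp hlim) ?_
  filter_upwards [eventually_gt_atTop 0] with N hN
  have hN' : (0 : ℝ) < N := Nat.cast_pos.mpr hN
  have hscaled : IsWall (L.map (scale N)) N (N * h) := by simpa using hL.map_scale hN'
  have hlength : ((L.map (scale N)).map List.length).sum = B := by
    simp [hB, scale, Function.comp_def]
  refine le_trans (EReal.coe_le_coe_iff.mpr ?_) (hscaled.natCeil_div_le_R (by positivity))
  change h * ((N : ℝ) / (N + B)) ≤ _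
  rw [hlength, Nat.cast_add, mul_div_assoc', mul_comm h]
  gcongr
  exact Nat.le_ceil _

end IsWall

end FirstFit

theorem theorem4p8 : (5 : EReal) ≤ FirstFit.R := by
  refine EReal.ge_of_forall_gt_iff_ge.mp fun h hh => ?_
  have hh5 : h < 5 := EReal.coe_lt_coe_iff.mp hh
  obtain ⟨L, hL⟩ := FirstFit.hasWall_one_of_lt_five (max_lt hh5 (by norm_num : (1 : ℝ) < 5))
  exact (EReal.coe_le_coe_iff.mpr (le_max_left h 1)).trans (hL.le_R (by positivity))
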